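/- For points of $\mathbb Z^2$, write $p\leftrightarrow_{c_2}q$ if $p\neq q$ and both coordinates differ by at most $1$, and $p\leftrightarrow_{c_1}q$ if in addition $p$ and $q$ differ in only one coordinate. A set $X\subset\mathbb Z^2$ with $c_2$-adjacency is regarded as a graph; a map $f:X\to X$ is $c_2$-continuous if it maps $c_2$-connected sets to $c_2$-connected sets, and $d_{c_2}$ is the path-length metric of $X$. If $X$ is $c_2$-connected, a set $A\subset X$ is a cold set for $(X,c_2)$ if every $c_2$-continuous $f:X\to X$ with $f|_A=\mathrm{id}_A$ satisfies $d_{c_2}(x,f(x))\le 1$ for all $x\in X$; it is minimal if no proper subset of $A$ is a cold set for $(X,c_2)$. A $c_2$-closed curve is a cyclic sequence $S=(s_i)_{i\in\mathbb Z/m}$, $m\ge 1$, of pairwise distinct points of $\mathbb Z^2$ whose consecutive members are $c_2$-adjacent or equal. If $\mathbb Z^2\setminus S$ has exactly two $c_1$-components, one finite (denoted $\mathrm{Int}(S)$) and one infinite, then $X=S\cup \mathrm{Int}(S)$ is a digital disk and $S$ is a bounding curve of $X$. A side (edge) of $S$ is a maximal digital line segment of $S$, that is, a maximal set of at least two consecutive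 points of $S$ that are collinear; its endpoints are its first and last points. A side is slanted if it has slope $\pm1$. The interior angle of $S$ at a common endpoint of two sides is the angle between these sides on the side of $\mathrm{Int}(S)$. A digital disk $X$ is thick if it has a bounding curve $S$ such that: (i) for every point $p$ of a slanted side of $S$ other than its endpoints there is $c\in X$ with $c\leftrightarrow_{c_2}p$ and $c\not\leftrightarrow_{c_1}p$; (ii) for every vertex $p$ of an interior angle of $90^\circ$ of $S$ there is $q\in \mathrm{Int}(S)$ such that $q\leftrightarrow_{c_1}p$ if the sides of the angle are slanted, and $q\leftrightarrow_{c_2}p$, $q\not\leftrightarrow_{c_1}p$ if they are axis-parallel; (iii) for every vertex $p$ of an interior angle of $135^\circ$ of $S$ there are $b,b'\in X$ in the interior of the angle with $b\leftrightarrow_{c_2}p$, $b\not\leftrightarrow_{c_1}p$ and $b'\leftrightarrow_{c_1}p$. Proposition. Let $X\subset\mathbb Z^2$ be a thick digital disk, and let $S$ be a bounding curve of $X$ that has exactly four sides, all of which are slanted. Let $A$ be the set of endpoints of the sides of $S$. Then $A$ is a minimal cold set for $(X,c_2)$. -/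

import Mathlib

namespace DigitalPlane

/-- `c₁`-adjacency (4-adjacency) on `ℤ²`: distinct points whose coordinates differ by at most `1`,
and which differ in at most one coordinate. -/
def c1 : SimpleGraph (ℤ × ℤ) where
  Adj p q := p ≠ q ∧ |p.1 - q.1| ≤ 1 ∧ |p.2 - q.2| ≤ 1 ∧ (p.1 = q.1 ∨ p.2 = q.2)
  symm := ⟨fun p q ⟨h, h1, h2, h3⟩ =>
    ⟨h.symm, by rwa [abs_sub_comm], by rwa [abs_sub_comm], h3.imp Eq.symm Eq.symm⟩⟩
  loopless := ⟨fun _ h => h.1 rfl⟩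

/-- `c₂`-adjacency (8-adjacency) on `ℤ²`: distinct points whose coordinates differ by at most
`1`. -/
def c2 : SimpleGraph (ℤ × ℤ) where
  Adj p q := p ≠ q ∧ |p.1 - q.1| ≤ 1 ∧ |p.2 - q.2| ≤ 1
  symm := ⟨fun p q ⟨h, h1, h2⟩ => ⟨h.symm, by rwa [abs_sub_comm], by rwa [abs_sub_comm]⟩⟩
  loopless := ⟨fun _ h => h.1 rfl⟩

/-! ### Continuous self-maps and cold sets -/

/-- A self-map of a digital image (a graph) is continuous if it maps connected sets to connected
sets. -/
def IsContinuous {V : Type*} (G : SimpleGraph V) (f : V → V) : Prop :=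
  ∀ Y : Set V, (G.induce Y).Preconnected → (G.induce (f '' Y)).Preconnected

/-- `A` is an `s`-cold set for the connected digital image `(X, κ)`; the distance is the
path-length metric of `(X, κ)`. -/
def IsSColdSet (κ : SimpleGraph (ℤ × ℤ)) (X : Set (ℤ × ℤ)) (s : ℕ) (A : Set (ℤ × ℤ)) : Prop :=
  (κ.induce X).Connected ∧ A ⊆ X ∧
    ∀ f : X → X, IsContinuous (κ.induce X) f → (∀ x : X, (x : ℤ × ℤ) ∈ A → f x = x) →
      ∀ x : X, (κ.induce X).dist x (f x) ≤ s

/-- A cold set is a `1`-cold set. -/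
def IsColdSet (κ : SimpleGraph (ℤ × ℤ)) (X A : Set (ℤ × ℤ)) : Prop :=
  IsSColdSet κ X 1 A

/-- A cold set no proper subset of which is a cold set. -/
def IsMinimalColdSet (κ : SimpleGraph (ℤ × ℤ)) (X A : Set (ℤ × ℤ)) : Prop :=
  IsColdSet κ X A ∧ ∀ B : Set (ℤ × ℤ), B ⊂ A → ¬ IsColdSet κ X B

/-! ### Digital line segments -/

/-- The points of `σ` lie on one line. -/
def IsCollinear (σ : Set (ℤ × ℤ)) : Prop :=
  ∀ p ∈ σ, ∀ q ∈ σ, ∀ r ∈ σ,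
    (q.1 - p.1) * (r.2 - p.2) = (r.1 - p.1) * (q.2 - p.2)

/-- A digital line segment: a finite connected set of at least two collinear points
(a `c₁`-connected set is also `c₂`-connected). -/
def IsDigitalSegment (σ : Set (ℤ × ℤ)) : Prop :=
  σ.Finite ∧ σ.Nontrivial ∧ (c2.induce σ).Preconnected ∧ IsCollinear σ

/-- All points of `σ` lie on a line of slope `1` or `-1`. -/
def IsSlanted (σ : Set (ℤ × ℤ)) : Prop :=
  (∀ p ∈ σ, ∀ q ∈ σ, p.1 - q.1 = p.2 - q.2) ∨ (∀ p ∈ σ, ∀ q ∈ σ, p.1 - q.1 = -(p.2 - q.2))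

/-! ### Closed curves and disks -/

/-- A digital `c₂`-closed curve: a cyclic sequence of pairwise distinct points
in which consecutive points are adjacent or equal. -/
structure ClosedCurve where
  m : ℕ
  [pos : NeZero m]
  pt : ZMod m → ℤ × ℤ
  inj : Function.Injective pt
  adj : ∀ i, pt i = pt (i + 1) ∨ c2.Adj (pt i) (pt (i + 1))

attribute [instance] ClosedCurve.pos

namespace ClosedCurve

variable (S : ClosedCurve)

/-- The set of points of the curve. -/
def carrier : Set (ℤ × ℤ) := Set.range S.pt

/-- The complement of the curve, with `c₁`-adjacency. -/
abbrev complGraph : SimpleGraph (S.carrierᶜ : Set (ℤ × ℤ)) := c1.induce S.carrierᶜ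

/-- The complement of the curve has exactly two `c₁`-components, one finite, one infinite. -/
def Separates : Prop :=
  ∃ C D : S.complGraph.ConnectedComponent,
    C.supp.Finite ∧ D.supp.Infinite ∧ ∀ E : S.complGraph.ConnectedComponent, E = C ∨ E = D

/-- `Int(S)`: the points off the curve whose `c₁`-component in the complement is finite. -/
def interior : Set (ℤ × ℤ) :=
  {p | ∃ h : p ∈ S.carrierᶜ, (S.complGraph.connectedComponentMk ⟨p, h⟩).supp.Finite}

/-- `S` is a bounding curve of the digital disk `X`. -/
def Bounds (X : Set (ℤ × ℤ)) : Prop :=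
  S.Separates ∧ X = S.carrier ∪ S.interior

/-- The points `s i, s (i + 1), …, s (i + k)` of the curve. -/
def arc (i : ZMod S.m) (k : ℕ) : Set (ℤ × ℤ) :=
  {p | ∃ j : ℕ, j ≤ k ∧ p = S.pt (i + j)}

/-- The arc of `k + 1` distinct points from `s i` to `s (i + k)` is a digital line segment. -/
def IsSegmentArc (i : ZMod S.m) (k : ℕ) : Prop :=
  1 ≤ k ∧ k < S.m ∧ IsDigitalSegment (S.arc i k)

/-- The arc from `s i` to `s (i + k)` is a side (edge) of the curve: a maximal digital line segment
in the curve. -/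
def IsSideArc (i : ZMod S.m) (k : ℕ) : Prop :=
  S.IsSegmentArc i k ∧
    ∀ i' k', S.IsSegmentArc i' k' → S.arc i k ⊆ S.arc i' k' → S.arc i' k' = S.arc i k

/-- The set of sides of the curve. -/
def sides : Set (Set (ℤ × ℤ)) :=
  {σ | ∃ i k, S.IsSideArc i k ∧ σ = S.arc i k}

/-- The set of endpoints of the sides of the curve. -/
def sideEndpoints : Set (ℤ × ℤ) :=
  {p | ∃ i k, S.IsSideArc i k ∧ (p = S.pt i ∨ p = S.pt (i + k))}

/-! ### Interior angles -/

/-- The winding number of the closed polygon `s 0, s 1, …` around a lattice point `q` off the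
curve: the number of edges that cross upwards, minus the number of edges that cross downwards, a ray
from `q` to the right that is tilted upwards infinitesimally. -/
def winding (q : ℤ × ℤ) : ℤ :=
  ∑ i : ZMod S.m,
    ((if (S.pt i).2 = q.2 ∧ (S.pt (i + 1)).2 = q.2 + 1 ∧ q.1 < (S.pt i).1 then 1 else 0) -
     (if (S.pt i).2 = q.2 + 1 ∧ (S.pt (i + 1)).2 = q.2 ∧ q.1 < (S.pt (i + 1)).1 then 1 else 0))

/-- The curve runs counterclockwise around its interior. -/
def IsCounterclockwise : Prop := ∀ q ∈ S.interior, 0 < S.winding q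

/-- The curve runs clockwise around its interior. -/
def IsClockwise : Prop := ∀ q ∈ S.interior, S.winding q < 0

end ClosedCurve

/-- The eight unit directions in counterclockwise order; `compass (u + 1)` is `compass u`
turned by `45°`. -/
def compass : ZMod 8 → ℤ × ℤ :=
  ![(1, 0), (1, 1), (0, 1), (-1, 1), (-1, 0), (-1, -1), (0, -1), (1, -1)]

/-- The direction `compass u` is slanted. -/
def IsSlantedDir (u : ZMod 8) : Prop :=
  (compass u).1 ≠ 0 ∧ (compass u).2 ≠ 0

namespace ClosedCurve

variable (S : ClosedCurve)

/-- The interior angle of the curve at the vertex `s i` is the sector that starts at the direction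
`compass u` and extends counterclockwise by `t * 45°`. Its two sides point to the neighbours of
`s i` on the curve, and it lies on the side of `Int(S)`: to the left of the curve if the curve runs
counterclockwise, to the right if it runs clockwise. -/
def IsInteriorAngle (i : ZMod S.m) (u : ZMod 8) (t : ℕ) : Prop :=
  0 < t ∧ t < 8 ∧
    ((S.IsCounterclockwise ∧
        S.pt (i + 1) = S.pt i + compass u ∧ S.pt (i - 1) = S.pt i + compass (u + t)) ∨
     (S.IsClockwise ∧
        S.pt (i - 1) = S.pt i + compass u ∧ S.pt (i + 1) = S.pt i + compass (u + t)))

/-! ### Thickness -/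

/-- `X` is slant-thick at `p`. -/
def SlantThickAt (X : Set (ℤ × ℤ)) (p : ℤ × ℤ) : Prop :=
  ∃ c ∈ X, c2.Adj c p ∧ ¬ c1.Adj p c

/-- The disk bounded by `S` is `90°`-thick at the vertex `p` of a `90°` interior angle that starts
at the direction `compass u`. (Both sides of the angle are slanted, or both are axis-parallel.) -/
def NinetyThickAt (p : ℤ × ℤ) (u : ZMod 8) : Prop :=
  ∃ q ∈ S.interior,
    (¬ IsSlantedDir u → c2.Adj q p ∧ ¬ c1.Adj p q) ∧ (IsSlantedDir u → c1.Adj q p)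

/-- `X` is `135°`-thick at the vertex `p` of a `135°` interior angle that starts at the direction
`compass u`. The points `p + compass (u + r)` with `0 < r < 3` are the `c₂`-neighbours of `p` in
the interior of the angle. -/
def OneThirtyFiveThickAt (X : Set (ℤ × ℤ)) (p : ℤ × ℤ) (u : ZMod 8) : Prop :=
  ∃ b ∈ X, ∃ b' ∈ X,
    (∃ r : ℕ, 0 < r ∧ r < 3 ∧ b = p + compass (u + r)) ∧
    (∃ r : ℕ, 0 < r ∧ r < 3 ∧ b' = p + compass (u + r)) ∧
    (c2.Adj b p ∧ ¬ c1.Adj p b) ∧ c1.Adj b' p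

end ClosedCurve

/-- `X` is a thick digital disk. -/
def IsThickDisk (X : Set (ℤ × ℤ)) : Prop :=
  ∃ S : ClosedCurve, S.Bounds X ∧
    (∀ i k, S.IsSideArc i k → IsSlanted (S.arc i k) →
      ∀ p ∈ S.arc i k, p ≠ S.pt i → p ≠ S.pt (i + k) → ClosedCurve.SlantThickAt X p) ∧
    (∀ i u, S.IsInteriorAngle i u 2 → S.NinetyThickAt (S.pt i) u) ∧
    (∀ i u, S.IsInteriorAngle i u 3 → ClosedCurve.OneThirtyFiveThickAt X (S.pt i) u)

end DigitalPlane

/-! A curve with only slanted sides moves by diagonal steps, and since it never backtracks, each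
change of direction is a right angle. The straight runs between turns are sides, so four sides leave
exactly four runs. Because the curve closes up, opposite runs are antiparallel and equally long:
`exists_slantedBoundary` identifies the curve with the boundary of a slanted rectangle and the side
endpoints with its corners. A parity-free argument in u = x + y and v = x - y
(`carrier_union_interior`) then shows that the disk is the full rectangle.

Continuity means that adjacent points go to adjacent or equal points, so neither coordinate changes
by more than 1 per step. If both ends of a segment are fixed, a coordinate that changes by exactly 1
at every step has no slack and is preserved (`fixed_on_line`). Along a slanted side this applies to
both coordinates, so fixing the corners fixes the boundary. Horizontal and vertical chords then fix
the first and the second coordinate of every point, so the map is the identity.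

No corner can be omitted: moving it alone two units inward along an axis is continuous and displaces
it by distance greater than 1 (`IsColdSet.mem_of_fold`). -/

namespace DigitalPlane

/-! ### Arcs, sides and turns of a closed curve -/

namespace ClosedCurve

variable (S : ClosedCurve)

/-- The step from `s i` to `s (i + 1)`. -/
def step (i : ZMod S.m) : ℤ × ℤ := S.pt (i + 1) - S.pt i

/-- The curve changes its direction at `s i`. -/
def IsTurn (i : ZMod S.m) : Prop := S.step i ≠ S.step (i - 1)

/-- Every step of the curve is diagonal. -/
def IsDiagonal : Prop :=
  ∀ i, ((S.step i).1 = 1 ∨ (S.step i).1 = -1) ∧ ((S.step i).2 = 1 ∨ (S.step i).2 = -1)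

variable {S}

theorem pt_add_one (i : ZMod S.m) : S.pt (i + 1) = S.pt i + S.step i := by
  simp [step]

theorem arc_subset_carrier (i : ZMod S.m) (k : ℕ) : S.arc i k ⊆ S.carrier := by
  rintro p ⟨j, -, rfl⟩
  exact ⟨_, rfl⟩

theorem carrier_finite : S.carrier.Finite := Set.finite_range _

theorem pt_mem_arc (i : ZMod S.m) {k j : ℕ} (h : j ≤ k) : S.pt (i + j) ∈ S.arc i k :=
  ⟨j, h, rfl⟩

theorem arc_preconnected (i : ZMod S.m) (k : ℕ) : (c2.induce (S.arc i k)).Preconnected := by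
  have key : ∀ j (hj : j ≤ k), (c2.induce (S.arc i k)).Reachable
      ⟨S.pt (i + (0 : ℕ)), pt_mem_arc i (Nat.zero_le k)⟩ ⟨S.pt (i + j), pt_mem_arc i hj⟩ := by
    intro j
    induction j with
    | zero => intro _; exact SimpleGraph.Reachable.refl _
    | succ j ih =>
      intro hj
      refine (ih (by omega)).trans ?_
      have hs : (i + ((j + 1 : ℕ) : ZMod S.m)) = i + j + 1 := by push_cast; ring
      rcases S.adj (i + j) with h | h
      · have : (⟨S.pt (i + j), pt_mem_arc i (by omega)⟩ : S.arc i k) =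
            ⟨S.pt (i + (j + 1 : ℕ)), pt_mem_arc i hj⟩ := Subtype.ext (h.trans (congrArg S.pt hs.symm))
        rw [this]
      · refine SimpleGraph.Adj.reachable ?_
        change c2.Adj (S.pt (i + j)) (S.pt (i + (j + 1 : ℕ)))
        rw [hs]; exact h
  rintro ⟨p, j, hj, rfl⟩ ⟨q, l, hl, rfl⟩
  exact (key j hj).symm.trans (key l hl)

theorem natCast_injOn {m a b : ℕ} (ha : a < m) (hb : b < m) (h : (a : ZMod m) = b) :
    a = b := by
  have := (ZMod.natCast_eq_natCast_iff' a b m).1 h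
  rwa [Nat.mod_eq_of_lt ha, Nat.mod_eq_of_lt hb] at this

theorem isSegmentArc_of_isCollinear {i : ZMod S.m} {k : ℕ} (hk : 1 ≤ k) (hkm : k < S.m)
    (hc : IsCollinear (S.arc i k)) : S.IsSegmentArc i k := by
  refine ⟨hk, hkm, carrier_finite.subset (arc_subset_carrier i k), ?_, arc_preconnected i k, hc⟩
  refine ⟨_, pt_mem_arc i (Nat.zero_le k), _, pt_mem_arc i hk, fun h => ?_⟩
  have h := natCast_injOn (by omega) (by omega) (add_left_cancel (S.inj h))
  omega

theorem isSegmentArc_one (hm : 2 ≤ S.m) (i : ZMod S.m) : S.IsSegmentArc i 1 := by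
  refine isSegmentArc_of_isCollinear le_rfl (by omega) ?_
  rintro _ ⟨j, hj, rfl⟩ _ ⟨k, hk, rfl⟩ _ ⟨l, hl, rfl⟩
  interval_cases j <;> interval_cases k <;> interval_cases l <;> ring

/-- The curve is finite, so it has finitely many segment arcs, and a maximal one exists above any
given one. -/
theorem exists_isSideArc_superset {i : ZMod S.m} {k : ℕ} (h : S.IsSegmentArc i k) :
    ∃ i' k', S.IsSideArc i' k' ∧ S.arc i k ⊆ S.arc i' k' := by
  let F : Set (Set (ℤ × ℤ)) := {σ | ∃ i' k', S.IsSegmentArc i' k' ∧ σ = S.arc i' k'}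
  have hF : F.Finite := by
    refine (carrier_finite (S := S)).powerset.subset ?_
    rintro _ ⟨i', k', -, rfl⟩
    exact arc_subset_carrier i' k'
  obtain ⟨σ, hle, hσ⟩ := hF.exists_le_maximal (a := S.arc i k) ⟨i, k, h, rfl⟩
  obtain ⟨i', k', h', rfl⟩ := hσ.prop
  refine ⟨i', k', ⟨h', fun i'' k'' h'' hs => ?_⟩, hle⟩
  exact Set.Subset.antisymm (hσ.le_of_ge ⟨i'', k'', h'', rfl⟩ hs) hs

/-- Each single step is a segment and extends to a side, whose slope it inherits. -/
theorem isDiagonal_of_isSlanted (hm : 2 ≤ S.m) (hslanted : ∀ σ ∈ S.sides, IsSlanted σ) :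
    S.IsDiagonal := by
  intro i
  obtain ⟨i', k', h, hsub⟩ := exists_isSideArc_superset (isSegmentArc_one hm i)
  have h0 := hsub (pt_mem_arc i (Nat.zero_le 1))
  have h1 := hsub (pt_mem_arc i (le_refl 1))
  simp only [Nat.cast_zero, add_zero, Nat.cast_one] at h0 h1
  have hne : S.pt i ≠ S.pt (i + 1) := by
    intro he
    have := S.inj he
    have h2 : ((0 : ℕ) : ZMod S.m) = (1 : ℕ) := by simpa [eq_comm] using this
    have := natCast_injOn (by omega) (by omega) h2
    omega
  have hadj := (S.adj i).resolve_left hne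
  obtain ⟨-, ha, hb⟩ := hadj
  rw [abs_le] at ha hb
  have hne' : (S.pt i).1 ≠ (S.pt (i + 1)).1 ∨ (S.pt i).2 ≠ (S.pt (i + 1)).2 := by
    by_contra! hc
    exact hne (Prod.ext hc.1 hc.2)
  simp only [step, Prod.fst_sub, Prod.snd_sub]
  rcases hslanted _ ⟨i', k', h, rfl⟩ with hs | hs <;>
  · have := hs _ h0 _ h1
    omega

/-- On a curve with at most two points, every segment arc is already the whole curve, which leaves
at most one side. -/
theorem three_le_m (hfour : S.sides.ncard = 4) : 3 ≤ S.m := by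
  by_contra! hlt
  have hsub : S.sides ⊆ {S.carrier} := by
    rintro _ ⟨i, k, ⟨⟨h1, h2, -⟩, -⟩, rfl⟩
    refine Set.Subset.antisymm (arc_subset_carrier i k) ?_
    rintro _ ⟨z, rfl⟩
    refine ⟨(z - i).val, ?_, by simp⟩
    have := ZMod.val_lt (z - i)
    omega
  have := Set.ncard_le_ncard hsub
  rw [hfour, Set.ncard_singleton] at this
  omega

theorem pt_sub_one_ne (hm : 3 ≤ S.m) (i : ZMod S.m) : S.pt (i - 1) ≠ S.pt (i + 1) := by
  intro h
  have h1 := S.inj h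
  have h2 : ((2 : ℕ) : ZMod S.m) = (0 : ℕ) := by
    push_cast
    linear_combination -h1
  have := natCast_injOn (by omega) (by omega) h2
  omega

/-- At a turn of a diagonal curve the two steps are orthogonal. -/
theorem IsTurn.orthogonal (hd : S.IsDiagonal) (hm : 3 ≤ S.m) {i : ZMod S.m} (h : S.IsTurn i) :
    (S.step (i - 1)).1 * (S.step i).1 + (S.step (i - 1)).2 * (S.step i).2 = 0 := by
  have hne := pt_sub_one_ne hm i
  have e1 := pt_add_one (S := S) (i - 1)
  rw [sub_add_cancel] at e1
  have e2 := pt_add_one (S := S) i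
  rw [e2, e1] at hne
  have h1 : ¬ ((S.step (i - 1)).1 + (S.step i).1 = 0 ∧ (S.step (i - 1)).2 + (S.step i).2 = 0) := by
    rintro ⟨ha, hb⟩
    apply hne
    ext <;> simp <;> linarith
  have h2 : ¬ ((S.step i).1 = (S.step (i - 1)).1 ∧ (S.step i).2 = (S.step (i - 1)).2) :=
    fun hc => h (Prod.ext hc.1 hc.2)
  rcases hd (i - 1) with ⟨ha | ha, hb | hb⟩ <;> rcases hd i with ⟨hc | hc, hd | hd⟩ <;>
    rw [ha, hb, hc, hd] at h1 h2 ⊢ <;> omega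

/-- A turn and its two neighbours on the curve are not collinear. -/
theorem IsTurn.not_collinear (hd : S.IsDiagonal) (hm : 3 ≤ S.m) {i : ZMod S.m} (h : S.IsTurn i)
    {σ : Set (ℤ × ℤ)} (hσ : IsCollinear σ) (h0 : S.pt i ∈ σ) (h1 : S.pt (i + 1) ∈ σ)
    (h2 : S.pt (i - 1) ∈ σ) : False := by
  have ho := h.orthogonal hd hm
  have e1 := pt_add_one (S := S) (i - 1)
  rw [sub_add_cancel] at e1
  have e2 := pt_add_one (S := S) i
  have hc := hσ _ h0 _ h1 _ h2
  rw [e2, e1] at hc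
  simp only [Prod.fst_add, Prod.snd_add, add_sub_cancel_left, sub_add_cancel_left] at hc
  rcases hd (i - 1) with ⟨ha | ha, hb | hb⟩ <;> rcases hd i with ⟨hc | hc, hd | hd⟩ <;>
    simp_all

/-- A segment containing the arc and reaching past one of its ends would contain a turn with both of
its neighbours, which are not collinear. This gives the maximality of runs, and also recovers the
index and length of a side from its point set. -/
theorem eq_of_arc_subset (hd : S.IsDiagonal) (hm : 3 ≤ S.m) {i i' : ZMod S.m} {k k' : ℕ}
    (hk : 1 ≤ k) (hkm : k < S.m) (hi : S.IsTurn i) (hik : S.IsTurn (i + k))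
    (h' : S.IsSegmentArc i' k') (hsub : S.arc i k ⊆ S.arc i' k') : i' = i ∧ k' = k := by
  obtain ⟨-, hkm', -, -, -, hcol⟩ := h'
  have m0 := hsub (pt_mem_arc i (Nat.zero_le k))
  have m1 := hsub (pt_mem_arc i hk)
  have m2 := hsub (pt_mem_arc i (Nat.sub_le k 1))
  have m3 := hsub (pt_mem_arc i (le_refl k))
  simp only [Nat.cast_zero, add_zero, Nat.cast_one] at m0 m1
  rw [Nat.cast_sub hk, Nat.cast_one, ← add_sub_assoc] at m2
  have hi' : i' = i := by
    obtain ⟨j, hj, hp⟩ := id m0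
    have hp := S.inj hp
    rcases Nat.eq_zero_or_pos j with rfl | hpos
    · simpa using hp.symm
    · refine (hi.not_collinear hd hm hcol m0 m1 ⟨j - 1, by omega, ?_⟩).elim
      rw [hp, Nat.cast_sub hpos, Nat.cast_one, add_sub_assoc]
  subst hi'
  refine ⟨rfl, ?_⟩
  obtain ⟨j, hj, hp⟩ := id m3
  have hp := add_left_cancel (S.inj hp)
  have hjk := natCast_injOn hkm (by omega) hp
  rcases hj.lt_or_eq with hlt | heq
  · refine (hik.not_collinear hd hm hcol m3 ⟨j + 1, hlt, ?_⟩ m2).elim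
    rw [hp]; push_cast; rw [add_assoc]
  · omega

theorem pt_add_of_step_eq {i : ZMod S.m} {k : ℕ} (h : ∀ j < k, S.step (i + j) = S.step i) :
    ∀ j ≤ k, S.pt (i + j) = S.pt i + (j : ℤ) • S.step i := by
  intro j
  induction j with
  | zero => simp
  | succ j ih =>
    intro hj
    have hs : (i + ((j + 1 : ℕ) : ZMod S.m)) = i + j + 1 := by push_cast; ring
    rw [hs, pt_add_one, ih (by omega), h j (by omega)]
    push_cast
    rw [add_smul, one_smul, add_assoc]

theorem isSideArc_of_turns (hd : S.IsDiagonal) (hm : 3 ≤ S.m) {i : ZMod S.m} {k : ℕ}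
    (hk : 1 ≤ k) (hkm : k < S.m) (hi : S.IsTurn i) (hik : S.IsTurn (i + k))
    (h : ∀ j < k, S.step (i + j) = S.step i) : S.IsSideArc i k := by
  refine ⟨isSegmentArc_of_isCollinear hk hkm ?_, fun i' k' h' hs => ?_⟩
  · rintro _ ⟨j, hj, rfl⟩ _ ⟨l, hl, rfl⟩ _ ⟨n, hn, rfl⟩
    rw [pt_add_of_step_eq h j hj, pt_add_of_step_eq h l hl, pt_add_of_step_eq h n hn]
    simp only [Prod.fst_add, Prod.snd_add, Prod.smul_fst, Prod.smul_snd, smul_eq_mul]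
    ring
  · obtain ⟨rfl, rfl⟩ := eq_of_arc_subset hd hm hk hkm hi hik h' hs
    rfl

/-- Without a turn, one trip around the curve would have displacement `S.m` times a fixed nonzero
step, yet it returns to its start. -/
theorem exists_isTurn (hd : S.IsDiagonal) : ∃ i, S.IsTurn i := by
  by_contra! hno
  have hs : ∀ i, S.step i = S.step (i - 1) := fun i => not_not.1 (hno i)
  have hc : ∀ n : ℕ, S.step (0 + n) = S.step 0 := by
    intro n
    induction n with
    | zero => simp
    | succ n ih => rw [hs, ← ih]; congr 1; push_cast; ring
  have h := congrArg Prod.fst (pt_add_of_step_eq (fun j _ => hc j) S.m le_rfl)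
  have hpos := NeZero.ne S.m
  simp only [CharP.cast_eq_zero, add_zero, Prod.fst_add, Prod.smul_fst, smul_eq_mul] at h
  rcases (hd 0).1 with h0 | h0 <;> rw [h0] at h <;> omega

/-- The next turn after `s (i + t)`. -/
theorem exists_next_turn {i : ZMod S.m} (hi : S.IsTurn i) {t : ℕ} (ht : t < S.m) :
    ∃ k : ℕ, 1 ≤ k ∧ t + k ≤ S.m ∧ S.IsTurn (i + (t + k : ℕ)) ∧
      ∀ j < k, S.step (i + t + j) = S.step (i + t) := by
  classical
  -- After a full trip the curve is back at the turn `s i`; the witness `S.m - t` also bounds the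
  -- next turn.
  have hex : ∃ k : ℕ, 1 ≤ k ∧ S.IsTurn (i + (t + k : ℕ)) :=
    ⟨S.m - t, by omega, by rwa [Nat.add_sub_cancel' ht.le, CharP.cast_eq_zero, add_zero]⟩
  refine ⟨Nat.find hex, (Nat.find_spec hex).1, ?_, (Nat.find_spec hex).2, fun j => ?_⟩
  · have := Nat.find_min' hex (m := S.m - t)
      ⟨by omega, by rwa [Nat.add_sub_cancel' ht.le, CharP.cast_eq_zero, add_zero]⟩
    omega
  · induction j with
    | zero => simp
    | succ j ih =>
      intro hj
      have hn := Nat.find_min hex hj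
      simp only [not_and, IsTurn, not_not] at hn
      have hs : i + ((t + (j + 1) : ℕ) : ZMod S.m) = i + t + (j + 1 : ℕ) := by push_cast; ring
      have hn := hn (by omega)
      rw [hs] at hn
      rw [hn, ← ih (by omega)]
      congr 1; push_cast; ring

end ClosedCurve

end DigitalPlane

/-! ### Four slanted sides form a slanted rectangle -/

namespace DigitalPlane

/-- The boundary of the slanted rectangle whose leftmost corner is `c` and whose sides of slope `1`
and `-1` have `a` and `b` steps. -/
def slantedBoundary (c : ℤ × ℤ) (a b : ℤ) : Set (ℤ × ℤ) :=
  {p | (0 ≤ (p.1 - c.1) + (p.2 - c.2) ∧ (p.1 - c.1) + (p.2 - c.2) ≤ 2 * a) ∧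
    (0 ≤ (p.1 - c.1) - (p.2 - c.2) ∧ (p.1 - c.1) - (p.2 - c.2) ≤ 2 * b) ∧
    ((p.1 - c.1) + (p.2 - c.2) = 0 ∨ (p.1 - c.1) + (p.2 - c.2) = 2 * a ∨
      (p.1 - c.1) - (p.2 - c.2) = 0 ∨ (p.1 - c.1) - (p.2 - c.2) = 2 * b)}

/-- The corners of the slanted rectangle. -/
def slantedCorners (c : ℤ × ℤ) (a b : ℤ) : Set (ℤ × ℤ) :=
  {p | ((p.1 - c.1) + (p.2 - c.2) = 0 ∨ (p.1 - c.1) + (p.2 - c.2) = 2 * a) ∧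
    ((p.1 - c.1) - (p.2 - c.2) = 0 ∨ (p.1 - c.1) - (p.2 - c.2) = 2 * b)}

/-- A rectangle spanned by two orthogonal diagonal directions in normal form. -/
theorem exists_slanted_normal_form (p₀ e f : ℤ × ℤ) (a b : ℤ) (ha : 1 ≤ a) (hb : 1 ≤ b)
    (he : (e.1 = 1 ∨ e.1 = -1) ∧ (e.2 = 1 ∨ e.2 = -1))
    (hf : (f.1 = 1 ∨ f.1 = -1) ∧ (f.2 = 1 ∨ f.2 = -1)) (hef : e.1 * f.1 + e.2 * f.2 = 0) :
    ∃ c : ℤ × ℤ, ∃ a' b' : ℤ, 1 ≤ a' ∧ 1 ≤ b' ∧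
      {p : ℤ × ℤ | ∃ x y : ℤ, 0 ≤ x ∧ x ≤ a ∧ 0 ≤ y ∧ y ≤ b ∧ (x = 0 ∨ x = a ∨ y = 0 ∨ y = b) ∧
        p = p₀ + x • e + y • f} = slantedBoundary c a' b' ∧
      {p : ℤ × ℤ | ∃ x y : ℤ, (x = 0 ∨ x = a) ∧ (y = 0 ∨ y = b) ∧ p = p₀ + x • e + y • f} =
        slantedCorners c a' b' := by
  have key : ∃ c : ℤ × ℤ, ∃ a' b' : ℤ, 1 ≤ a' ∧ 1 ≤ b' ∧ (∀ p : ℤ × ℤ,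
      p ∈ slantedBoundary c a' b' ↔
        ∃ x y : ℤ, 0 ≤ x ∧ x ≤ a ∧ 0 ≤ y ∧ y ≤ b ∧ (x = 0 ∨ x = a ∨ y = 0 ∨ y = b) ∧
          p.1 = p₀.1 + x * e.1 + y * f.1 ∧ p.2 = p₀.2 + x * e.2 + y * f.2) ∧
      ∀ p : ℤ × ℤ, p ∈ slantedCorners c a' b' ↔ ∃ x y : ℤ, (x = 0 ∨ x = a) ∧ (y = 0 ∨ y = b) ∧
          p.1 = p₀.1 + x * e.1 + y * f.1 ∧ p.2 = p₀.2 + x * e.2 + y * f.2 := by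
    obtain ⟨e1, e2⟩ := e
    obtain ⟨f1, f2⟩ := f
    obtain ⟨x₀, y₀⟩ := p₀
    dsimp only at he hf hef ⊢
    -- Coordinates in the orthogonal basis `e`, `f`: inner products halved, as both vectors have
    -- squared length 2. Packing them as opaque functions keeps the divisions out of sight until the
    -- witnesses are needed.
    obtain ⟨wx, hwx⟩ : ∃ w : ℤ × ℤ → ℤ, ∀ p, w p = ((p.1 - x₀) * e1 + (p.2 - y₀) * e2) / 2 :=
      ⟨_, fun _ => rfl⟩
    obtain ⟨wy, hwy⟩ : ∃ w : ℤ × ℤ → ℤ, ∀ p, w p = ((p.1 - x₀) * f1 + (p.2 - y₀) * f2) / 2 :=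
      ⟨_, fun _ => rfl⟩
    -- The leftmost corner is reached from `p₀` by the full side along each of `e`, `f` that points
    -- left. The side along `e` has slope 1 exactly when `e1 = e2`.
    refine ⟨(x₀ + (if e1 = -1 then -a else 0) + (if f1 = -1 then -b else 0),
      y₀ + (if e1 = -1 then a * e2 else 0) + (if f1 = -1 then b * f2 else 0)),
      if e1 = e2 then a else b, if e1 = e2 then b else a, ?_⟩
    simp only [slantedBoundary, slantedCorners, Set.mem_ofPred_eq]
    rcases he with ⟨rfl | rfl, rfl | rfl⟩ <;> rcases hf with ⟨rfl | rfl, rfl | rfl⟩ <;>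
      first
      | (exfalso; omega)
      | skip
    all_goals
      norm_num only [if_true, if_false]
      refine ⟨by omega, by omega, fun p => ⟨fun h => ?_, ?_⟩, fun p => ⟨fun h => ?_, ?_⟩⟩
    all_goals first
      | (rintro ⟨x, y, h⟩; omega)
      | skip
    all_goals
      have h₁ := hwx p
      have h₂ := hwy p
      exact ⟨wx p, wy p, by omega⟩
  obtain ⟨c, a', b', h1, h2, h3, h4⟩ := key
  refine ⟨c, a', b', h1, h2, ?_, ?_⟩ <;> ext p <;>
    simp [h3, h4, Prod.ext_iff]

namespace ClosedCurve

variable {S : ClosedCurve}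

/-- The maximal straight run that starts at a turn. -/
theorem exists_run (hd : S.IsDiagonal) (hm : 3 ≤ S.m) {i : ZMod S.m} (hi : S.IsTurn i) {t : ℕ}
    (ht : t < S.m) (hit : S.IsTurn (i + t)) :
    ∃ k : ℕ, 1 ≤ k ∧ t + k ≤ S.m ∧ S.IsTurn (i + (t + k : ℕ)) ∧
      (∀ j ≤ k, S.pt (i + (t + j : ℕ)) = S.pt (i + t) + (j : ℤ) • S.step (i + t)) ∧
      (S.step (i + t)).1 * (S.step (i + (t + k : ℕ))).1 +
        (S.step (i + t)).2 * (S.step (i + (t + k : ℕ))).2 = 0 ∧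
      (k < S.m → S.IsSideArc (i + t) k) := by
  obtain ⟨k, hk, hkm, hturn, hstep⟩ := exists_next_turn hi ht
  have hadd : ∀ j : ℕ, i + ((t + j : ℕ) : ZMod S.m) = i + t + j := fun j => by push_cast; ring
  refine ⟨k, hk, hkm, hturn, fun j hj => ?_, ?_, fun hlt => ?_⟩
  · rw [hadd]; exact pt_add_of_step_eq hstep j hj
  · have ho := hturn.orthogonal hd hm
    have hlast := hstep (k - 1) (by omega)
    rw [Nat.cast_sub hk, Nat.cast_one, ← add_sub_assoc, ← hadd] at hlast
    rwa [hlast] at ho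
  · exact isSideArc_of_turns hd hm hk hlt hit (by rwa [← hadd]) hstep

/-- This turns a count of runs into a count of sides: the point set of a run determines its starting
turn. -/
theorem arc_injective_of_turns (hd : S.IsDiagonal) (hm : 3 ≤ S.m) (i : ZMod S.m) {n : ℕ}
    {T K : Fin n → ℕ} (hT : Function.Injective T) (hTm : ∀ j, T j < S.m)
    (hK : ∀ j, 1 ≤ K j ∧ K j < S.m) (hs : ∀ j, S.IsSideArc (i + T j) (K j))
    (h0 : ∀ j, S.IsTurn (i + T j)) (h1 : ∀ j, S.IsTurn (i + (T j + K j : ℕ))) :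
    Function.Injective fun j => S.arc (i + T j) (K j) := by
  intro j l hjl
  have := (eq_of_arc_subset hd hm (hK j).1 (hK j).2 (h0 j)
    (by have := h1 j; rwa [Nat.cast_add, ← add_assoc] at this) (hs l).1 hjl.le).1
  exact (hT (natCast_injOn (hTm l) (hTm j) (add_left_cancel this))).symm

/-- Four alternating diagonal vectors that close up form a rectangle. -/
theorem rectangle_of_closed {e f g h p : ℤ × ℤ} {a b c d : ℤ} (ha : 1 ≤ a) (hb : 1 ≤ b)
    (hc : 1 ≤ c) (hd : 1 ≤ d)
    (he : (e.1 = 1 ∨ e.1 = -1) ∧ (e.2 = 1 ∨ e.2 = -1))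
    (hf : (f.1 = 1 ∨ f.1 = -1) ∧ (f.2 = 1 ∨ f.2 = -1))
    (hg : (g.1 = 1 ∨ g.1 = -1) ∧ (g.2 = 1 ∨ g.2 = -1))
    (hh : (h.1 = 1 ∨ h.1 = -1) ∧ (h.2 = 1 ∨ h.2 = -1))
    (hef : e.1 * f.1 + e.2 * f.2 = 0) (hfg : f.1 * g.1 + f.2 * g.2 = 0)
    (hgh : g.1 * h.1 + g.2 * h.2 = 0)
    (hclosed : p = p + a • e + b • f + c • g + d • h) : g = -e ∧ h = -f ∧ c = a ∧ d = b := by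
  have h1 := congrArg Prod.fst hclosed
  have h2 := congrArg Prod.snd hclosed
  obtain ⟨e1, e2⟩ := e
  obtain ⟨f1, f2⟩ := f
  obtain ⟨g1, g2⟩ := g
  obtain ⟨h1, h2⟩ := h
  simp only [Prod.fst_add, Prod.snd_add, Prod.smul_fst, Prod.smul_snd, smul_eq_mul,
    Prod.neg_mk, Prod.mk.injEq] at *
  clear hclosed
  rcases he with ⟨rfl | rfl, rfl | rfl⟩ <;> rcases hf with ⟨rfl | rfl, rfl | rfl⟩ <;>
    first
    | (exfalso; omega)
    | (rcases hg with ⟨rfl | rfl, rfl | rfl⟩ <;>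
        first
        | (exfalso; omega)
        | (rcases hh with ⟨rfl | rfl, rfl | rfl⟩ <;> omega))

/-- Both `e` and `g` are orthogonal to `f`, so nothing can cancel `b • f`. No sign is imposed on
`c`, so that `c = 0` covers two runs. -/
theorem not_closed_three {e f g p : ℤ × ℤ} {a b c : ℤ} (hb : 1 ≤ b)
    (he : (e.1 = 1 ∨ e.1 = -1) ∧ (e.2 = 1 ∨ e.2 = -1))
    (hf : (f.1 = 1 ∨ f.1 = -1) ∧ (f.2 = 1 ∨ f.2 = -1))
    (hg : (g.1 = 1 ∨ g.1 = -1) ∧ (g.2 = 1 ∨ g.2 = -1))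
    (hef : e.1 * f.1 + e.2 * f.2 = 0) (hfg : f.1 * g.1 + f.2 * g.2 = 0)
    (hclosed : p = p + a • e + b • f + c • g) : False := by
  have h1 := congrArg Prod.fst hclosed
  have h2 := congrArg Prod.snd hclosed
  obtain ⟨e1, e2⟩ := e
  obtain ⟨f1, f2⟩ := f
  obtain ⟨g1, g2⟩ := g
  simp only [Prod.fst_add, Prod.snd_add, Prod.smul_fst, Prod.smul_snd, smul_eq_mul] at *
  clear hclosed
  rcases he with ⟨rfl | rfl, rfl | rfl⟩ <;> rcases hf with ⟨rfl | rfl, rfl | rfl⟩ <;>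
    first
    | (exfalso; omega)
    | (rcases hg with ⟨rfl | rfl, rfl | rfl⟩ <;> omega)

/-- A closed curve with exactly four sides, all slanted, is the boundary of a slanted rectangle. -/
theorem exists_slantedBoundary (hfour : S.sides.ncard = 4)
    (hslanted : ∀ σ ∈ S.sides, IsSlanted σ) :
    ∃ c : ℤ × ℤ, ∃ a b : ℤ, 1 ≤ a ∧ 1 ≤ b ∧ S.carrier = slantedBoundary c a b ∧
      S.sideEndpoints = slantedCorners c a b := by
  have hm := three_le_m hfour
  have hd := isDiagonal_of_isSlanted (by omega) hslanted
  obtain ⟨i, hi⟩ := exists_isTurn hd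
  have hfin : S.sides.Finite := Set.finite_of_ncard_ne_zero (by omega)
  have hclose : S.pt (i + (S.m : ℕ)) = S.pt (i + (0 : ℕ)) := by simp
  have hi0 : S.IsTurn (i + (0 : ℕ)) := by simpa using hi
  obtain ⟨k₁, hk₁, hm₁, ht₁, hp₁, ho₁, hs₁⟩ := exists_run hd hm hi (by omega) hi0
  -- The trip cannot end after one, two or three runs, since their displacements do not sum to zero.
  have hlt₁ : 0 + k₁ < S.m := by
    refine hm₁.lt_of_ne fun heq => ?_
    have h := hp₁ k₁ le_rfl
    rw [heq, hclose] at h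
    have h := congrArg Prod.fst h
    simp only [Prod.fst_add, Prod.smul_fst, smul_eq_mul] at h
    rcases (hd (i + (0 : ℕ))).1 with h0 | h0 <;> rw [h0] at h <;> omega
  obtain ⟨k₂, hk₂, hm₂, ht₂, hp₂, ho₂, hs₂⟩ := exists_run hd hm hi hlt₁ ht₁
  have hlt₂ : 0 + k₁ + k₂ < S.m := by
    refine hm₂.lt_of_ne fun heq => ?_
    have h := hp₂ k₂ le_rfl
    rw [heq, hclose, hp₁ k₁ le_rfl] at h
    exact not_closed_three (a := k₁) (b := k₂) (c := 0) (by omega) (hd _) (hd _) (hd _) ho₁ ho₂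
      (h.trans (by rw [zero_smul, add_zero]))
  obtain ⟨k₃, hk₃, hm₃, ht₃, hp₃, ho₃, hs₃⟩ := exists_run hd hm hi hlt₂ ht₂
  have hlt₃ : 0 + k₁ + k₂ + k₃ < S.m := by
    refine hm₃.lt_of_ne fun heq => ?_
    have h := hp₃ k₃ le_rfl
    rw [heq, hclose, hp₂ k₂ le_rfl, hp₁ k₁ le_rfl] at h
    exact not_closed_three (by omega) (hd _) (hd _) (hd _) ho₁ ho₂ h
  obtain ⟨k₄, hk₄, hm₄, ht₄, hp₄, ho₄, hs₄⟩ := exists_run hd hm hi hlt₃ ht₃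
  -- If the curve did not close after four runs, a fifth run would be a fifth side.
  have heq₄ : 0 + k₁ + k₂ + k₃ + k₄ = S.m := by
    by_contra hne
    obtain ⟨k₅, hk₅, hm₅, ht₅, hp₅, ho₅, hs₅⟩ := exists_run hd hm hi (hm₄.lt_of_ne hne) ht₄
    have hinj := arc_injective_of_turns hd hm i (n := 5)
      (T := ![0, 0 + k₁, 0 + k₁ + k₂, 0 + k₁ + k₂ + k₃, 0 + k₁ + k₂ + k₃ + k₄])
      (K := ![k₁, k₂, k₃, k₄, k₅])
      (by
        refine StrictMono.injective (Fin.strictMono_iff_lt_succ.2 fun j => ?_)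
        fin_cases j <;> simp <;> omega)
      (by intro j; fin_cases j <;> simp <;> omega)
      (by intro j; fin_cases j <;> simp <;> omega)
      (by
        intro j
        fin_cases j
        exacts [hs₁ (by omega), hs₂ (by omega), hs₃ (by omega), hs₄ (by omega), hs₅ (by omega)])
      (by intro j; fin_cases j; exacts [hi0, ht₁, ht₂, ht₃, ht₄])
      (by intro j; fin_cases j; exacts [ht₁, ht₂, ht₃, ht₄, ht₅])
    have hsub : Set.range (fun j : Fin 5 => S.arc (i + ((![0, 0 + k₁, 0 + k₁ + k₂,
        0 + k₁ + k₂ + k₃, 0 + k₁ + k₂ + k₃ + k₄] : Fin 5 → ℕ) j : ℕ))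
          ((![k₁, k₂, k₃, k₄, k₅] : Fin 5 → ℕ) j)) ⊆ S.sides := by
      rintro _ ⟨j, rfl⟩
      fin_cases j
      exacts [⟨_, _, hs₁ (by omega), rfl⟩, ⟨_, _, hs₂ (by omega), rfl⟩,
        ⟨_, _, hs₃ (by omega), rfl⟩, ⟨_, _, hs₄ (by omega), rfl⟩, ⟨_, _, hs₅ (by omega), rfl⟩]
    have hcard := Set.ncard_le_ncard hsub hfin
    rw [← Set.image_univ, Set.ncard_image_of_injective _ hinj, Set.ncard_univ, Nat.card_fin,
      hfour] at hcard
    omega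
  have hs₁ := hs₁ (by omega)
  have hs₂ := hs₂ (by omega)
  have hs₃ := hs₃ (by omega)
  have hs₄ := hs₄ (by omega)
  -- The four runs are distinct sides, hence by cardinality all of them.
  have hsides : ∀ σ ∈ S.sides, ∃ j : Fin 4, σ = S.arc
      (i + ((![0, 0 + k₁, 0 + k₁ + k₂, 0 + k₁ + k₂ + k₃] : Fin 4 → ℕ) j : ℕ))
      ((![k₁, k₂, k₃, k₄] : Fin 4 → ℕ) j) := by
    have hinj := arc_injective_of_turns hd hm i (n := 4)
      (T := ![0, 0 + k₁, 0 + k₁ + k₂, 0 + k₁ + k₂ + k₃]) (K := ![k₁, k₂, k₃, k₄])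
      (by
        refine StrictMono.injective (Fin.strictMono_iff_lt_succ.2 fun j => ?_)
        fin_cases j <;> simp <;> omega)
      (by intro j; fin_cases j <;> simp <;> omega)
      (by intro j; fin_cases j <;> simp <;> omega)
      (by intro j; fin_cases j; exacts [hs₁, hs₂, hs₃, hs₄])
      (by intro j; fin_cases j; exacts [hi0, ht₁, ht₂, ht₃])
      (by intro j; fin_cases j; exacts [ht₁, ht₂, ht₃, ht₄])
    have hsub : Set.range (fun j : Fin 4 => S.arc (i + ((![0, 0 + k₁, 0 + k₁ + k₂,
        0 + k₁ + k₂ + k₃] : Fin 4 → ℕ) j : ℕ)) ((![k₁, k₂, k₃, k₄] : Fin 4 → ℕ) j)) ⊆ S.sides := by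
      rintro _ ⟨j, rfl⟩
      fin_cases j
      exacts [⟨_, _, hs₁, rfl⟩, ⟨_, _, hs₂, rfl⟩, ⟨_, _, hs₃, rfl⟩, ⟨_, _, hs₄, rfl⟩]
    have hcard := Set.eq_of_subset_of_ncard_le hsub (by
      rw [← Set.image_univ, Set.ncard_image_of_injective _ hinj, Set.ncard_univ, Nat.card_fin,
        hfour]) hfin
    intro σ hσ
    rw [← hcard] at hσ
    obtain ⟨j, hj⟩ := hσ
    exact ⟨j, hj.symm⟩
  have q₁ := hp₁ k₁ le_rfl
  have q₂ := hp₂ k₂ le_rfl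
  have q₃ := hp₃ k₃ le_rfl
  have q₄ := hp₄ k₄ le_rfl
  have hends : S.sideEndpoints = {S.pt (i + (0 : ℕ)), S.pt (i + (0 + k₁ : ℕ)),
      S.pt (i + (0 + k₁ + k₂ : ℕ)), S.pt (i + (0 + k₁ + k₂ + k₃ : ℕ))} := by
    ext p
    simp only [Set.mem_insert_iff, Set.mem_singleton_iff]
    constructor
    · rintro ⟨i', k', hs, hp⟩
      obtain ⟨j, hj⟩ := hsides _ ⟨i', k', hs, rfl⟩
      have hsame : ∀ {t k : ℕ}, 1 ≤ k → k < S.m → S.IsTurn (i + t) →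
          S.IsTurn (i + (t + k : ℕ)) → S.arc i' k' = S.arc (i + t) k →
          p = S.pt (i + t) ∨ p = S.pt (i + (t + k : ℕ)) := by
        intro t k h1 h2 h3 h4 h5
        rw [Nat.cast_add, ← add_assoc] at h4 ⊢
        obtain ⟨rfl, rfl⟩ := eq_of_arc_subset hd hm h1 h2 h3 h4 hs.1 h5.ge
        exact hp
      fin_cases j
      · rcases hsame hk₁ (by omega) hi0 ht₁ hj with h | h <;> simp [h]
      · rcases hsame hk₂ (by omega) ht₁ ht₂ hj with h | h <;> simp [h]
      · rcases hsame hk₃ (by omega) ht₂ ht₃ hj with h | h <;> simp [h]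
      · rcases hsame hk₄ (by omega) ht₃ ht₄ hj with h | h
        · simp [h]
        · rw [heq₄, hclose] at h
          exact Or.inl h
    · rintro (rfl | rfl | rfl | rfl)
      exacts [⟨_, _, hs₁, Or.inl rfl⟩, ⟨_, _, hs₂, Or.inl rfl⟩, ⟨_, _, hs₃, Or.inl rfl⟩,
        ⟨_, _, hs₄, Or.inl rfl⟩]
  obtain ⟨hg, hh, hca, hdb⟩ := rectangle_of_closed (p := S.pt (i + (0 : ℕ)))
    (a := k₁) (b := k₂) (c := k₃) (d := k₄)
    (by omega) (by omega) (by omega) (by omega) (hd _) (hd _) (hd _) (hd _) ho₁ ho₂ ho₃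
    (by rw [← q₁, ← q₂, ← q₃, ← q₄, heq₄, hclose])
  rw [q₁] at hp₂ q₂
  rw [q₂, hg] at hp₃ q₃
  rw [q₃, hh, hca] at hp₄
  rw [hca] at q₃
  rw [Nat.cast_inj] at hca hdb
  obtain ⟨c, a, b, ha, hb, hbd, hcor⟩ := exists_slanted_normal_form (S.pt (i + (0 : ℕ)))
    _ _ k₁ k₂ (by omega) (by omega) (hd _) (hd _) ho₁
  refine ⟨c, a, b, ha, hb, ?_, ?_⟩
  · rw [← hbd]
    ext p
    constructor
    -- The position of `z` counted from the initial turn falls in one of the four runs; the last two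
    -- traverse their sides backwards.
    · rintro ⟨z, rfl⟩
      have hlt := ZMod.val_lt (z - i)
      have hz : z = i + ((z - i).val : ℕ) := by simp
      generalize (z - i).val = n at hlt hz
      subst hz
      rcases le_total n (0 + k₁) with h₁ | h₁
      · refine ⟨n, 0, by omega, by omega, by omega, by omega, by omega, ?_⟩
        have := hp₁ n (by omega)
        rw [Nat.zero_add] at this
        rw [this]; module
      obtain ⟨n, rfl⟩ := Nat.exists_eq_add_of_le h₁
      rcases le_total n k₂ with h₂ | h₂
      · exact ⟨k₁, n, by omega, by omega, by omega, by omega, by omega, hp₂ n h₂⟩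
      obtain ⟨n, rfl⟩ := Nat.exists_eq_add_of_le h₂
      rw [← Nat.add_assoc] at hlt ⊢
      rcases le_total n k₃ with h₃ | h₃
      · refine ⟨k₁ - n, k₂, by omega, by omega, by omega, by omega, by omega, ?_⟩
        rw [hp₃ n h₃]; module
      obtain ⟨n, rfl⟩ := Nat.exists_eq_add_of_le h₃
      rw [← Nat.add_assoc] at hlt ⊢
      refine ⟨0, k₂ - n, by omega, by omega, by omega, by omega, by omega, ?_⟩
      rw [hp₄ n (by omega)]; module
    · rintro ⟨x, y, hx0, hxa, hy0, hyb, hxy, rfl⟩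
      lift x to ℕ using hx0
      lift y to ℕ using hy0
      rcases hxy with hx | hx | hy | hy
      · refine ⟨i + (0 + k₁ + k₂ + k₃ + (k₂ - y) : ℕ), ?_⟩
        rw [hp₄ _ (by omega), hx, Nat.cast_sub (by omega)]; module
      · refine ⟨i + (0 + k₁ + y : ℕ), ?_⟩
        rw [hp₂ _ (by omega), hx]
      · refine ⟨i + (0 + x : ℕ), ?_⟩
        rw [hp₁ _ (by omega), hy]; module
      · refine ⟨i + (0 + k₁ + k₂ + (k₁ - x) : ℕ), ?_⟩
        rw [hp₃ _ (by omega), hy, Nat.cast_sub (by omega)]; module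
  · rw [← hcor, hends, q₃, q₂, q₁]
    ext p
    simp only [Set.mem_insert_iff, Set.mem_singleton_iff, Set.mem_ofPred_eq]
    constructor
    · rintro (rfl | rfl | rfl | rfl)
      · exact ⟨0, 0, by omega, by omega, by module⟩
      · exact ⟨k₁, 0, by omega, by omega, by module⟩
      · exact ⟨k₁, k₂, by omega, by omega, by module⟩
      · exact ⟨0, k₂, by omega, by omega, by module⟩
    · rintro ⟨x, y, rfl | rfl, rfl | rfl, rfl⟩
      · left; module
      · right; right; right; module
      · right; left; module
      · right; right; left; module

end ClosedCurve

end DigitalPlane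

/-! ### Continuity in terms of adjacency -/

namespace DigitalPlane

/-- The image of the connected pair `{x, y}` is connected, so a walk in it that leaves `f x` must
step to `f y`. -/
theorem IsContinuous.eq_or_adj {V : Type*} {G : SimpleGraph V} {f : V → V}
    (hf : IsContinuous G f) {x y : V} (h : G.Adj x y) : f x = f y ∨ G.Adj (f x) (f y) := by
  by_cases hne : f x = f y
  · exact Or.inl hne
  right
  have hpre : (G.induce {x, y}).Preconnected := by
    have hxy : (G.induce {x, y}).Reachable ⟨x, by simp⟩ ⟨y, by simp⟩ :=
      SimpleGraph.Adj.reachable (by simpa using h)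
    rintro ⟨a, rfl | rfl⟩ ⟨b, rfl | rfl⟩
    exacts [SimpleGraph.Reachable.refl _, hxy, hxy.symm, SimpleGraph.Reachable.refl _]
  obtain ⟨w⟩ := hf _ hpre ⟨f x, x, by simp, rfl⟩ ⟨f y, y, by simp, rfl⟩
  obtain ⟨⟨_, z, hz, rfl⟩, hadj, -, -⟩ :=
    w.exists_eq_cons_of_ne fun h => hne (congrArg Subtype.val h)
  rcases hz with rfl | rfl
  · exact (hadj.ne rfl).elim
  · exact hadj

/-- Such a map sends walks to walks, up to pauses. -/
theorem isContinuous_of_eq_or_adj {V : Type*} {G : SimpleGraph V} {f : V → V}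
    (hf : ∀ x y, G.Adj x y → f x = f y ∨ G.Adj (f x) (f y)) : IsContinuous G f := by
  intro Y hY
  have key : ∀ x y : Y, (G.induce Y).Walk x y → (G.induce (f '' Y)).Reachable
      ⟨f x, x, x.2, rfl⟩ ⟨f y, y, y.2, rfl⟩ := by
    intro x y w
    induction w with
    | nil => exact SimpleGraph.Reachable.refl _
    | @cons x z y hadj _ ih =>
      refine SimpleGraph.Reachable.trans ?_ ih
      rcases hf x z hadj with h | h
      · have : (⟨f x, x, x.2, rfl⟩ : f '' Y) = ⟨f z, z, z.2, rfl⟩ := Subtype.ext h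
        rw [this]
      · exact SimpleGraph.Adj.reachable (by simpa using h)
  rintro ⟨_, x, hx, rfl⟩ ⟨_, y, hy, rfl⟩
  obtain ⟨w⟩ := hY ⟨x, hx⟩ ⟨y, hy⟩
  exact key _ _ w

/-! ### The interior of a slanted rectangular curve -/

/-- The slanted rectangle with leftmost corner `c`. -/
def slantedRect (c : ℤ × ℤ) (a b : ℤ) : Set (ℤ × ℤ) :=
  {p | (0 ≤ (p.1 - c.1) + (p.2 - c.2) ∧ (p.1 - c.1) + (p.2 - c.2) ≤ 2 * a) ∧
    (0 ≤ (p.1 - c.1) - (p.2 - c.2) ∧ (p.1 - c.1) - (p.2 - c.2) ≤ 2 * b)}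

theorem slantedRect_finite (c : ℤ × ℤ) (a b : ℤ) : (slantedRect c a b).Finite := by
  refine (Set.finite_Icc (c.1, c.2 - b) (c.1 + a + b, c.2 + a)).subset ?_
  rintro ⟨x, y⟩ h
  simp only [slantedRect, Set.mem_ofPred_eq] at h
  simp only [Set.mem_Icc, Prod.mk_le_mk]
  omega

namespace ClosedCurve

variable {S : ClosedCurve}

/-- A `c1`-step changes x + y and x - y by exactly 1 each, so it cannot jump across a boundary line.
The component therefore stays in the finite rectangle. -/
theorem mem_interior_of_mem_slantedRect {c : ℤ × ℤ} {a b : ℤ} (hS : S.carrier = slantedBoundary c a b)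
    {p : ℤ × ℤ} (hp : p ∈ slantedRect c a b) (hpc : p ∉ S.carrier) : p ∈ S.interior := by
  refine ⟨hpc, ?_⟩
  have key : ∀ x y : (S.carrierᶜ : Set (ℤ × ℤ)), S.complGraph.Walk x y →
      (x : ℤ × ℤ) ∈ slantedRect c a b → (y : ℤ × ℤ) ∈ slantedRect c a b := by
    intro x y w
    induction w with
    | nil => exact id
    | @cons x z y hadj _ ih =>
      intro hx
      refine ih ?_
      obtain ⟨⟨x1, x2⟩, hxc⟩ := x
      obtain ⟨⟨z1, z2⟩, hzc⟩ := z
      obtain ⟨hne, h1, h2, h3⟩ : c1.Adj (x1, x2) (z1, z2) := hadj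
      have hx' : (x1, x2) ∉ slantedBoundary c a b := hS ▸ hxc
      have hz' : (z1, z2) ∉ slantedBoundary c a b := hS ▸ hzc
      simp only [abs_le] at h1 h2
      simp only [slantedBoundary, slantedRect, Set.mem_ofPred_eq] at hx hx' hz' h3 ⊢
      omega
  refine Set.Finite.of_finite_image (f := Subtype.val)
    ((slantedRect_finite c a b).subset ?_) Subtype.val_injective.injOn
  rintro _ ⟨q, hq, rfl⟩
  obtain ⟨w⟩ := (SimpleGraph.ConnectedComponent.exact hq).symm
  exact key _ _ w hp

theorem not_mem_interior_of_ray {p : ℤ × ℤ} (s : ℤ) (hs : s = 1 ∨ s = -1)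
    (hray : ∀ n : ℕ, (p.1 + s * n, p.2) ∈ S.carrierᶜ) : p ∉ S.interior := by
  rintro ⟨hpc, hfin⟩
  have key : ∀ n : ℕ, S.complGraph.Reachable ⟨(p.1 + s * n, p.2), hray n⟩ ⟨p, hpc⟩ := by
    intro n
    induction n with
    | zero =>
      have : (⟨(p.1 + s * (0 : ℕ), p.2), hray 0⟩ : (S.carrierᶜ : Set (ℤ × ℤ))) = ⟨p, hpc⟩ :=
        Subtype.ext (by simp)
      rw [this]
    | succ n ih =>
      refine (SimpleGraph.Adj.reachable ?_).trans ih
      change c1.Adj (p.1 + s * (n + 1 : ℕ), p.2) (p.1 + s * n, p.2)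
      refine ⟨fun h => ?_, ?_, by simp, Or.inr rfl⟩
      · have := congrArg Prod.fst h
        rcases hs with rfl | rfl <;> simp at this
      · rcases hs with rfl | rfl <;> simp
  refine Set.infinite_of_injective_forall_mem (f := fun n : ℕ =>
    (⟨(p.1 + s * n, p.2), hray n⟩ : (S.carrierᶜ : Set (ℤ × ℤ)))) ?_ ?_ hfin
  · intro m n h
    have h := congrArg (fun q => (Subtype.val q).1) h
    rcases hs with rfl | rfl <;> simpa using h
  · exact fun n => SimpleGraph.ConnectedComponent.sound (key n)

/-- Moving left lowers both x + y and x - y, and moving right raises both. From outside, one of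
these horizontal rays never meets the curve, so the component is infinite. -/
theorem mem_slantedRect_of_mem_interior {c : ℤ × ℤ} {a b : ℤ}
    (hS : S.carrier = slantedBoundary c a b)
    {p : ℤ × ℤ} (hp : p ∈ S.interior) : p ∈ slantedRect c a b := by
  by_contra hout
  by_cases hl : (p.1 - c.1) + (p.2 - c.2) < 0 ∨ (p.1 - c.1) - (p.2 - c.2) < 0
  · refine not_mem_interior_of_ray (-1) (Or.inr rfl) (fun n => ?_) hp
    simp only [hS, slantedBoundary, Set.mem_compl_iff, Set.mem_ofPred_eq]
    omega
  · refine not_mem_interior_of_ray 1 (Or.inl rfl) (fun n => ?_) hp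
    simp only [hS, slantedBoundary, slantedRect, Set.mem_compl_iff, Set.mem_ofPred_eq] at hout ⊢
    omega

theorem carrier_union_interior {c : ℤ × ℤ} {a b : ℤ}
    (hS : S.carrier = slantedBoundary c a b) :
    S.carrier ∪ S.interior = slantedRect c a b := by
  ext p
  constructor
  · rintro (h | h)
    · rw [hS] at h
      exact ⟨h.1, h.2.1⟩
    · exact mem_slantedRect_of_mem_interior hS h
  · intro h
    by_cases hc : p ∈ S.carrier
    · exact Or.inl hc
    · exact Or.inr (mem_interior_of_mem_slantedRect hS h hc)

end ClosedCurve

/-! ### The corners form a cold set -/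

theorem c2_adj_line {x y e₁ e₂ : ℤ} (he₁ : |e₁| ≤ 1) (he₂ : |e₂| ≤ 1) (he : e₁ ≠ 0 ∨ e₂ ≠ 0)
    (j : ℕ) : c2.Adj (x + (j : ℕ) * e₁, y + (j : ℕ) * e₂)
      (x + (j + 1 : ℕ) * e₁, y + (j + 1 : ℕ) * e₂) := by
  rw [abs_le] at he₁ he₂
  refine ⟨fun h => ?_, abs_le.2 ?_, abs_le.2 ?_⟩
  · simp only [Prod.mk.injEq] at h
    push_cast at h
    ring_nf at h
    omega
  · push_cast; ring_nf; omega
  · push_cast; ring_nf; omega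

theorem reachable_line {X : Set (ℤ × ℤ)} {x y e₁ e₂ : ℤ} (he₁ : |e₁| ≤ 1) (he₂ : |e₂| ≤ 1)
    (he : e₁ ≠ 0 ∨ e₂ ≠ 0) {n : ℕ} (hX : ∀ j : ℕ, j ≤ n → (x + j * e₁, y + j * e₂) ∈ X)
    {p q : X} (hp : (p : ℤ × ℤ) = (x, y)) (hq : (q : ℤ × ℤ) = (x + n * e₁, y + n * e₂)) :
    (c2.induce X).Reachable p q := by
  have key : ∀ j : ℕ, ∀ hj : j ≤ n,
      (c2.induce X).Reachable p ⟨(x + j * e₁, y + j * e₂), hX j hj⟩ := by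
    intro j
    induction j with
    | zero =>
      intro hj
      have : p = ⟨(x + (0 : ℕ) * e₁, y + (0 : ℕ) * e₂), hX 0 hj⟩ := Subtype.ext (by simp [hp])
      rw [← this]
    | succ j ih =>
      intro hj
      exact (ih (by omega)).trans (SimpleGraph.Adj.reachable (c2_adj_line he₁ he₂ he j))
  have := key n le_rfl
  rwa [show q = ⟨(x + n * e₁, y + n * e₂), hX n le_rfl⟩ from Subtype.ext hq]

/-- A map that moves adjacent points to adjacent or equal points and fixes both ends of a segment
preserves every coordinate that is monotone along the segment. -/
theorem fixed_on_line {X : Set (ℤ × ℤ)} {g : ℤ × ℤ → ℤ × ℤ}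
    (hg : ∀ p ∈ X, ∀ q ∈ X, c2.Adj p q →
      |(g p).1 - (g q).1| ≤ 1 ∧ |(g p).2 - (g q).2| ≤ 1)
    {x y e₁ e₂ : ℤ} (he₁ : |e₁| ≤ 1) (he₂ : |e₂| ≤ 1)
    (he : e₁ ≠ 0 ∨ e₂ ≠ 0) {n : ℕ} (hX : ∀ j : ℕ, j ≤ n → (x + j * e₁, y + j * e₂) ∈ X)
    (h0 : g (x, y) = (x, y)) (hn : g (x + n * e₁, y + n * e₂) = (x + n * e₁, y + n * e₂))
    {j : ℕ} (hj : j ≤ n) :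
    (e₁ ≠ 0 → (g (x + j * e₁, y + j * e₂)).1 = x + j * e₁) ∧
      (e₂ ≠ 0 → (g (x + j * e₁, y + j * e₂)).2 = y + j * e₂) := by
  have key : ∀ i l : ℕ, i + l ≤ n →
      |(g (x + i * e₁, y + i * e₂)).1 - (g (x + (i + l : ℕ) * e₁, y + (i + l : ℕ) * e₂)).1| ≤ l ∧
      |(g (x + i * e₁, y + i * e₂)).2 - (g (x + (i + l : ℕ) * e₁, y + (i + l : ℕ) * e₂)).2| ≤ l := by
    intro i l
    induction l with
    | zero => simp
    | succ l ih =>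
      intro hl
      have h1 := ih (by omega)
      have h2 := hg _ (hX (i + l) (by omega)) _ (hX (i + l + 1) (by omega))
        (c2_adj_line he₁ he₂ he (i + l))
      rw [← Nat.add_assoc]
      simp only [abs_le] at h1 h2 ⊢
      generalize (g (x + (i + l + 1 : ℕ) * e₁, y + (i + l + 1 : ℕ) * e₂)) = r at *
      generalize (g (x + (i + l : ℕ) * e₁, y + (i + l : ℕ) * e₂)) = s at *
      push_cast
      omega
  -- The distances from the two fixed ends are at most `j` and `n - j`. In a nonconstant coordinate
  -- the ends are exactly `n` apart, so both bounds are attained.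
  have k1 := key 0 j (by omega)
  have k2 := key j (n - j) (by omega)
  rw [Nat.add_sub_cancel' hj, hn] at k2
  simp only [Nat.cast_zero, zero_mul, add_zero, h0, Nat.zero_add] at k1
  generalize g (x + j * e₁, y + j * e₂) = r at *
  have e1 : e₁ = 0 ∨ e₁ = 1 ∨ e₁ = -1 := by rw [abs_le] at he₁; omega
  have e2 : e₂ = 0 ∨ e₂ = 1 ∨ e₂ = -1 := by rw [abs_le] at he₂; omega
  simp only [abs_le] at k1 k2
  constructor
  · intro hne
    rcases e1 with rfl | rfl | rfl <;> omega
  · intro hne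
    rcases e2 with rfl | rfl | rfl <;> omega

theorem slantedRect_connected {c : ℤ × ℤ} {a b : ℤ} (ha : 1 ≤ a) (hb : 1 ≤ b) :
    (c2.induce (slantedRect c a b)).Connected := by
  obtain ⟨x₀, y₀⟩ := c
  have hc : (x₀, y₀) ∈ slantedRect (x₀, y₀) a b := by
    simp only [slantedRect, Set.mem_ofPred_eq]; omega
  refine (SimpleGraph.connected_iff_exists_forall_reachable _).2 ⟨⟨_, hc⟩, ?_⟩
  rintro ⟨⟨x, y⟩, h⟩
  have h' := h
  simp only [slantedRect, Set.mem_ofPred_eq] at h'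
  -- Path from the leftmost corner: `k` diagonal steps along a left side up or down to height `y`,
  -- then `l` steps to the right.
  obtain ⟨k, hk⟩ := Int.eq_ofNat_of_zero_le (show 0 ≤ |y - y₀| from abs_nonneg _)
  obtain ⟨l, hl⟩ := Int.eq_ofNat_of_zero_le (show 0 ≤ x - x₀ - |y - y₀| by
    have : |y - y₀| ≤ x - x₀ := abs_le.2 (by omega)
    omega)
  rw [hk] at hl
  have hmid : (x - l, y) ∈ slantedRect (x₀, y₀) a b := by
    simp only [slantedRect, Set.mem_ofPred_eq]
    rcases abs_cases (y - y₀) with hy | hy <;> omega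
  have hrow : (c2.induce (slantedRect (x₀, y₀) a b)).Reachable ⟨_, hmid⟩ ⟨_, h⟩ := by
    refine reachable_line (x := x - l) (y := y) (e₁ := 1) (e₂ := 0) (n := l) (by simp) (by simp)
      (by simp) (fun j hj => ?_) rfl (by simp)
    simp only [slantedRect, Set.mem_ofPred_eq] at hmid ⊢
    omega
  refine SimpleGraph.Reachable.trans ?_ hrow
  rcases abs_cases (y - y₀) with hy | hy
  · refine reachable_line (x := x₀) (y := y₀) (e₁ := 1) (e₂ := 1) (n := k) (by simp) (by simp)
      (by simp) (fun j hj => ?_) rfl (by simp only [Prod.mk.injEq]; omega)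
    simp only [slantedRect, Set.mem_ofPred_eq] at hmid ⊢
    omega
  · refine reachable_line (x := x₀) (y := y₀) (e₁ := 1) (e₂ := -1) (n := k) (by simp) (by simp)
      (by simp) (fun j hj => ?_) rfl (by simp only [Prod.mk.injEq]; omega)
    simp only [slantedRect, Set.mem_ofPred_eq] at hmid ⊢
    omega

section Fixed

variable {x₀ y₀ a b : ℤ} {g : ℤ × ℤ → ℤ × ℤ}

/-- Both coordinates vary strictly along a slanted side, so `fixed_on_line` fixes its points
completely once the two corners are fixed. -/
theorem fixed_boundary (ha : 1 ≤ a) (hb : 1 ≤ b)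
    (hg : ∀ p ∈ slantedRect (x₀, y₀) a b, ∀ q ∈ slantedRect (x₀, y₀) a b, c2.Adj p q →
      |(g p).1 - (g q).1| ≤ 1 ∧ |(g p).2 - (g q).2| ≤ 1)
    (hfix : ∀ p ∈ slantedCorners (x₀, y₀) a b, g p = p)
    {p : ℤ × ℤ} (hp : p ∈ slantedBoundary (x₀, y₀) a b) : g p = p := by
  have key : ∀ (x y e : ℤ) (n : ℕ), e = 1 ∨ e = -1 →
      (∀ j : ℕ, j ≤ n → (x + j * 1, y + j * e) ∈ slantedRect (x₀, y₀) a b) →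
      (x, y) ∈ slantedCorners (x₀, y₀) a b →
      (x + n * 1, y + n * e) ∈ slantedCorners (x₀, y₀) a b →
      0 ≤ p.1 - x → p.1 - x ≤ n → p.2 - y = (p.1 - x) * e → g p = p := by
    intro x y e n he hX h0 hn hp0 hpn hpe
    obtain ⟨j, hj⟩ := Int.eq_ofNat_of_zero_le hp0
    have h := fixed_on_line hg (by simp) (by rcases he with rfl | rfl <;> simp) (by simp) hX
      (hfix _ h0) (hfix _ hn) (j := j) (by omega)
    have hpj : p = (x + j * 1, y + j * e) := by
      rw [hj] at hpe
      exact Prod.ext (by simp; omega) (by simp; omega)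
    rw [← hpj] at h
    refine Prod.ext ((h.1 one_ne_zero).trans (by omega)) ((h.2 ?_).trans ?_)
    · rcases he with rfl | rfl <;> simp
    · rw [hj] at hpe; omega
  obtain ⟨A, hA⟩ := Int.eq_ofNat_of_zero_le (show 0 ≤ a by omega)
  obtain ⟨B, hB⟩ := Int.eq_ofNat_of_zero_le (show 0 ≤ b by omega)
  simp only [slantedBoundary, slantedRect, slantedCorners, Set.mem_ofPred_eq] at key hp
  obtain ⟨h1, h2, h | h | h | h⟩ := hp
  · exact key x₀ y₀ (-1) B (by omega) (by omega) (by omega) (by omega) (by omega) (by omega)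
      (by omega)
  · exact key (x₀ + a) (y₀ + a) (-1) B (by omega) (by omega) (by omega) (by omega) (by omega)
      (by omega) (by omega)
  · exact key x₀ y₀ 1 A (by omega) (by omega) (by omega) (by omega) (by omega) (by omega)
      (by omega)
  · exact key (x₀ + b) (y₀ - b) 1 A (by omega) (by omega) (by omega) (by omega) (by omega)
      (by omega) (by omega)

theorem fixed_slantedRect (ha : 1 ≤ a) (hb : 1 ≤ b)
    (hg : ∀ p ∈ slantedRect (x₀, y₀) a b, ∀ q ∈ slantedRect (x₀, y₀) a b, c2.Adj p q →
      |(g p).1 - (g q).1| ≤ 1 ∧ |(g p).2 - (g q).2| ≤ 1)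
    (hfix : ∀ p ∈ slantedCorners (x₀, y₀) a b, g p = p)
    {p : ℤ × ℤ} (hp : p ∈ slantedRect (x₀, y₀) a b) : g p = p := by
  have hbd : ∀ q ∈ slantedBoundary (x₀, y₀) a b, g q = q :=
    fun q hq => fixed_boundary ha hb hg hfix hq
  obtain ⟨x, y⟩ := p
  have hp' := hp
  simp only [slantedRect, Set.mem_ofPred_eq] at hp'
  refine Prod.ext ?_ ?_
  -- Horizontal chord: a step left lowers both x + y and x - y by 1, so the boundary is met exactly
  -- when the smaller slack is used up; likewise to the right.
  · obtain ⟨l, hl⟩ : ∃ l : ℕ, (l : ℤ) = min (x + y - x₀ - y₀) ((x - x₀) - (y - y₀)) :=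
      ⟨_, Int.toNat_of_nonneg (by omega)⟩
    obtain ⟨r, hr⟩ : ∃ r : ℕ, (r : ℤ) =
        min (2 * a - (x + y - x₀ - y₀)) (2 * b - ((x - x₀) - (y - y₀))) :=
      ⟨_, Int.toNat_of_nonneg (by omega)⟩
    have h := (fixed_on_line hg (x := x - l) (y := y) (e₁ := 1) (e₂ := 0) (n := l + r) (by simp)
      (by simp) (by simp) (fun j hj => by simp only [slantedRect, Set.mem_ofPred_eq]; omega)
      (hbd _ (by simp only [slantedBoundary, Set.mem_ofPred_eq]; omega))
      (hbd _ (by simp only [slantedBoundary, Set.mem_ofPred_eq]; omega))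
      (j := l) (by omega)).1 one_ne_zero
    simpa using h
  -- Vertical chord: a step down lowers x + y but raises x - y, so the slacks are paired
  -- differently.
  · obtain ⟨l, hl⟩ : ∃ l : ℕ, (l : ℤ) = min (x + y - x₀ - y₀) (2 * b - ((x - x₀) - (y - y₀))) :=
      ⟨_, Int.toNat_of_nonneg (by omega)⟩
    obtain ⟨r, hr⟩ : ∃ r : ℕ, (r : ℤ) =
        min (2 * a - (x + y - x₀ - y₀)) ((x - x₀) - (y - y₀)) :=
      ⟨_, Int.toNat_of_nonneg (by omega)⟩
    have h := (fixed_on_line hg (x := x) (y := y - l) (e₁ := 0) (e₂ := 1) (n := l + r) (by simp)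
      (by simp) (by simp) (fun j hj => by simp only [slantedRect, Set.mem_ofPred_eq]; omega)
      (hbd _ (by simp only [slantedBoundary, Set.mem_ofPred_eq]; omega))
      (hbd _ (by simp only [slantedBoundary, Set.mem_ofPred_eq]; omega))
      (j := l) (by omega)).2 one_ne_zero
    simpa using h

end Fixed

theorem slantedCorners_subset {c : ℤ × ℤ} {a b : ℤ} (ha : 1 ≤ a) (hb : 1 ≤ b) :
    slantedCorners c a b ⊆ slantedRect c a b := by
  intro p hp
  simp only [slantedRect, slantedCorners, Set.mem_ofPred_eq] at hp ⊢
  omega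

/-- A continuous self-map of a slanted rectangle that fixes the corners is the identity. -/
theorem eq_self_of_fixes_corners {c : ℤ × ℤ} {a b : ℤ} (ha : 1 ≤ a) (hb : 1 ≤ b)
    {f : slantedRect c a b → slantedRect c a b}
    (hf : IsContinuous (c2.induce (slantedRect c a b)) f)
    (hfix : ∀ x : slantedRect c a b, (x : ℤ × ℤ) ∈ slantedCorners c a b → f x = x)
    (x : slantedRect c a b) : f x = x := by
  classical
  -- The extension by the identity is arbitrary: only values on the rectangle are used.
  let g : ℤ × ℤ → ℤ × ℤ := fun p => if h : p ∈ slantedRect c a b then f ⟨p, h⟩ else p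
  have hgf : ∀ p (h : p ∈ slantedRect c a b), g p = f ⟨p, h⟩ := fun p h => dif_pos h
  refine Subtype.ext ((hgf x x.2).symm.trans (fixed_slantedRect (x₀ := c.1) (y₀ := c.2) ha hb
    (fun p hp q hq hpq => ?_) (fun p hp => ?_) x.2))
  · rw [hgf p hp, hgf q hq]
    rcases hf.eq_or_adj (x := ⟨p, hp⟩) (y := ⟨q, hq⟩) hpq with h | h
    · simp [h]
    · exact h.2
  · rw [hgf p (slantedCorners_subset ha hb hp), hfix _ hp]

/-- The displacement is in fact 0, by rigidity. -/
theorem isColdSet_slantedCorners {c : ℤ × ℤ} {a b : ℤ} (ha : 1 ≤ a) (hb : 1 ≤ b) :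
    IsColdSet c2 (slantedRect c a b) (slantedCorners c a b) := by
  refine ⟨slantedRect_connected ha hb, slantedCorners_subset ha hb, fun f hf hfix x => ?_⟩
  rw [eq_self_of_fixes_corners ha hb hf hfix x, SimpleGraph.dist_self]
  exact Nat.zero_le 1

/-! ### Minimality -/

/-- If every neighbour of `p` in `X` is adjacent or equal to a point `q` at distance at least `2`
from `p`, then a cold set contains `p`. -/
theorem IsColdSet.mem_of_fold {X B : Set (ℤ × ℤ)} (hB : IsColdSet c2 X B) {p q : ℤ × ℤ}
    (hp : p ∈ X) (hq : q ∈ X) (hpq : p ≠ q) (hpq' : ¬ c2.Adj p q)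
    (hnb : ∀ r ∈ X, c2.Adj p r → r = q ∨ c2.Adj q r) : p ∈ B := by
  classical
  by_contra hpB
  obtain ⟨hconn, -, hcold⟩ := hB
  -- The map moves only `p`, to `q`; the condition on the neighbours of `p` is exactly its
  -- continuity.
  have h := hcold (fun x => if (x : ℤ × ℤ) = p then ⟨q, hq⟩ else x)
    (isContinuous_of_eq_or_adj ?_) ?_ ⟨p, hp⟩
  · simp only [if_true] at h
    rcases Nat.le_one_iff_eq_zero_or_eq_one.1 h with h | h
    · exact hpq (congrArg Subtype.val (hconn.dist_eq_zero_iff.1 h))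
    · have hadj : (c2.induce X).Adj ⟨p, hp⟩ ⟨q, hq⟩ := SimpleGraph.dist_eq_one_iff_adj.1 h
      exact hpq' hadj
  · rintro ⟨x, hx⟩ ⟨y, hy⟩ (hxy : c2.Adj x y)
    by_cases hxp : x = p
    · subst hxp
      have hyx : y ≠ x := hxy.ne'
      simp only [if_true, hyx, if_false]
      rcases hnb y hy hxy with rfl | h
      · exact Or.inl rfl
      · exact Or.inr h
    · by_cases hyp : y = p
      · subst hyp
        simp only [if_true, hxp, if_false]
        rcases hnb x hx hxy.symm with rfl | h
        · exact Or.inl rfl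
        · exact Or.inr h.symm
      · simp only [hxp, hyp, if_false]
        exact Or.inr hxy
  · intro x hx
    have : (x : ℤ × ℤ) ≠ p := fun h => hpB (h ▸ hx)
    simp [this]

theorem isMinimalColdSet_slantedCorners {c : ℤ × ℤ} {a b : ℤ} (ha : 1 ≤ a) (hb : 1 ≤ b) :
    IsMinimalColdSet c2 (slantedRect c a b) (slantedCorners c a b) := by
  refine ⟨isColdSet_slantedCorners ha hb, fun B hBA hB => hBA.2 fun p hp => ?_⟩
  obtain ⟨x, y⟩ := p
  -- The point two units from the corner along the inward axis lies in the rectangle because `a` and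
  -- `b` are at least 1. The corner's neighbours in the rectangle all lie one unit inward, hence
  -- within one unit of that point.
  obtain ⟨d₁, d₂, hd⟩ : ∃ d₁ d₂ : ℤ, ((d₁ = 2 ∧ d₂ = 0) ∨ (d₁ = -2 ∧ d₂ = 0) ∨
      (d₁ = 0 ∧ d₂ = 2) ∨ (d₁ = 0 ∧ d₂ = -2)) ∧
      (x + d₁, y + d₂) ∈ slantedRect c a b ∧ ∀ r ∈ slantedRect c a b, c2.Adj (x, y) r →
        r = (x + d₁, y + d₂) ∨ c2.Adj (x + d₁, y + d₂) r := by
    have hadj : ∀ d₁ d₂ : ℤ, ∀ r, |x + d₁ - r.1| ≤ 1 → |y + d₂ - r.2| ≤ 1 →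
        r = (x + d₁, y + d₂) ∨ c2.Adj (x + d₁, y + d₂) r := fun d₁ d₂ r h1 h2 =>
      or_iff_not_imp_left.2 fun hne => ⟨fun h => hne h.symm, h1, h2⟩
    simp only [slantedCorners, Set.mem_ofPred_eq] at hp
    obtain ⟨hu | hu, hv | hv⟩ := hp
    · refine ⟨2, 0, by omega, ?_, fun r hr h => ?_⟩
      · simp only [slantedRect, Set.mem_ofPred_eq]; omega
      · obtain ⟨hne, h1, h2⟩ := h
        have hne : ¬ (x = r.1 ∧ y = r.2) := fun h => hne (Prod.ext h.1 h.2)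
        simp only [slantedRect, Set.mem_ofPred_eq, abs_le] at hr h1 h2
        exact hadj _ _ _ (abs_le.2 (by omega)) (abs_le.2 (by omega))
    · refine ⟨0, 2, by omega, ?_, fun r hr h => ?_⟩
      · simp only [slantedRect, Set.mem_ofPred_eq]; omega
      · obtain ⟨hne, h1, h2⟩ := h
        have hne : ¬ (x = r.1 ∧ y = r.2) := fun h => hne (Prod.ext h.1 h.2)
        simp only [slantedRect, Set.mem_ofPred_eq, abs_le] at hr h1 h2
        exact hadj _ _ _ (abs_le.2 (by omega)) (abs_le.2 (by omega))
    · refine ⟨0, -2, by omega, ?_, fun r hr h => ?_⟩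
      · simp only [slantedRect, Set.mem_ofPred_eq]; omega
      · obtain ⟨hne, h1, h2⟩ := h
        have hne : ¬ (x = r.1 ∧ y = r.2) := fun h => hne (Prod.ext h.1 h.2)
        simp only [slantedRect, Set.mem_ofPred_eq, abs_le] at hr h1 h2
        exact hadj _ _ _ (abs_le.2 (by omega)) (abs_le.2 (by omega))
    · refine ⟨-2, 0, by omega, ?_, fun r hr h => ?_⟩
      · simp only [slantedRect, Set.mem_ofPred_eq]; omega
      · obtain ⟨hne, h1, h2⟩ := h
        have hne : ¬ (x = r.1 ∧ y = r.2) := fun h => hne (Prod.ext h.1 h.2)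
        simp only [slantedRect, Set.mem_ofPred_eq, abs_le] at hr h1 h2
        exact hadj _ _ _ (abs_le.2 (by omega)) (abs_le.2 (by omega))
  obtain ⟨hd, hmem, hnb⟩ := hd
  refine hB.mem_of_fold (slantedCorners_subset ha hb hp) hmem (fun h => ?_) (fun h => ?_) hnb
  · simp only [Prod.mk.injEq] at h; omega
  · obtain ⟨-, h1, h2⟩ := h
    simp only [abs_le] at h1 h2
    omega

end DigitalPlane

theorem proposition7p1 (X : Set (ℤ × ℤ)) (hX : DigitalPlane.IsThickDisk X)
    (S : DigitalPlane.ClosedCurve) (hS : S.Bounds X)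
    (hfour : S.sides.ncard = 4) (hslanted : ∀ σ ∈ S.sides, DigitalPlane.IsSlanted σ) :
    DigitalPlane.IsMinimalColdSet DigitalPlane.c2 X S.sideEndpoints := by
  obtain ⟨c, a, b, ha, hb, hcarrier, hends⟩ :=
    DigitalPlane.ClosedCurve.exists_slantedBoundary hfour hslanted
  rw [hS.2, DigitalPlane.ClosedCurve.carrier_union_interior hcarrier, hends]
  exact DigitalPlane.isMinimalColdSet_slantedCorners ha hb
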